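/- Let $X$ be a topological space, with all closures taken in $X$. A subset $A\subseteq X$ is called *relatively o-radial* in $X$ if for every family $(O_i)_{i\in I}$ of open subsets of $X$ and every $x\in A$ with $$x\in\overline{\bigcup_{i\in I}(O_i\cap A)}\setminus\bigcup_{i\in I}\overline{O_i},$$ there is a set $J\subseteq I$ whose cardinality $|J|$ is a regular (infinite) cardinal such that $x\in\overline{\bigcup_{j\in L}O_j}$ whenever $L\subseteq J$ and $|L|=|J|$. The space $X$ is *functionally generated* (respectively, *strongly functionally generated*) by a collection $\mathcal M$ of subsets of $X$ if for every discontinuous function $f:X\to\mathbb R$ there is $A\in\mathcal M$ such that the restriction $f|_A$ has no continuous extension to $X$ (respectively, $f|_A:A\to\mathbb R$ is discontinuous on the subspace $A$). A map $f:X\to Y$ between uniform spaces is *proximally continuous* if $g\circ f$ is uniformly continuous for every bounded uniformly continuous function $g:Y\to\mathbb R$. A uniform space $X$ is *proximally fine* if every proximally continuous map from $X$ into a uniform space is uniformly continuous. A topological group $G$ is called *proximally fine* if it is proximally fine as a uniform space equipped with its right uniformity, which has as a basis the sets $\{(g,h)\in G\times G: gh^{-1}\in V\}$, where $V$ runs over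 the neighborhoods of the unit. **Theorem 2.4.** Let $G$ be a topological group satisfying at least one of the following: 1. $G$ is functionally generated by the collection of the closures $\overline A$ of the sets $A\subseteq G$ such that $AA^{-1}$ is relatively o-radial in $G$; 2. $G$ is strongly functionally generated by the collection of the sets $A\subseteq G$ that are relatively o-radial in $G$. Then $G$ is proximally fine. -/

import Mathlib

open scoped Pointwise

universe u v

/-- A map `f` between uniform spaces is proximally continuous if `g ∘ f` is uniformly continuous
for every bounded uniformly continuous real-valued function `g` on the target. -/
def ProximallyContinuous {X : Type u} {Y : Type v} [UniformSpace X] [UniformSpace Y]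
    (f : X → Y) : Prop :=
  ∀ g : Y → ℝ, UniformContinuous g → (∃ C : ℝ, ∀ y, |g y| ≤ C) → UniformContinuous (g ∘ f)

/-- A uniform space `X` is proximally fine if every proximally continuous map from `X` to a
uniform space is uniformly continuous. The universe `v` of the target spaces is arbitrary. -/
def ProximallyFine (X : Type u) [UniformSpace X] : Prop :=
  ∀ (Y : Type v) [UniformSpace Y] (f : X → Y), ProximallyContinuous f → UniformContinuous f

/-- A topological group is proximally fine if it is so as a uniform space with its right
uniformity, generated by the sets `{(g, h) | h * g⁻¹ ∈ V}` for `V` a neighbourhood of `1`. -/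
def ProximallyFineGroup (G : Type u) [Group G] [TopologicalSpace G] [IsTopologicalGroup G] :
    Prop :=
  @ProximallyFine.{u, v} G (IsTopologicalGroup.rightUniformSpace G)

/-- The subset `A` of `X` is relatively o-radial in `X`. -/
def RelativelyORadial {X : Type u} [TopologicalSpace X] (A : Set X) : Prop :=
  ∀ (I : Type u) (O : I → Set X), (∀ i, IsOpen (O i)) →
    ∀ x ∈ A, x ∈ closure (⋃ i, O i ∩ A) \ ⋃ i, closure (O i) →
      ∃ J : Set I, (Cardinal.mk J).IsRegular ∧
        ∀ L : Set I, L ⊆ J → Cardinal.mk L = Cardinal.mk J → x ∈ closure (⋃ j ∈ L, O j)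

/-- `X` is functionally generated by the collection `M` of subsets of `X`: every discontinuous
real function on `X` has, for some `A ∈ M`, a restriction to `A` without continuous extension
to `X`. -/
def FunctionallyGenerated (X : Type u) [TopologicalSpace X] (M : Set (Set X)) : Prop :=
  ∀ f : X → ℝ, ¬ Continuous f → ∃ A ∈ M, ¬ ∃ g : X → ℝ, Continuous g ∧ Set.EqOn g f A

/-- `X` is strongly functionally generated by the collection `M` of subsets of `X`: every
discontinuous real function on `X` has a discontinuous restriction to the subspace `A` for some
`A ∈ M`. -/
def StronglyFunctionallyGenerated (X : Type u) [TopologicalSpace X] (M : Set (Set X)) : Prop :=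
  ∀ f : X → ℝ, ¬ Continuous f → ∃ A ∈ M, ¬ Continuous (fun a : A => f a)

open Filter Topology Uniformity Set

/-! Given an entourage of the target, a uniformly continuous pseudometric bounded by 1 reduces the
theorem to bounded pseudometric targets. Since right entourages relate `g` to `v * g` with `v` near
1, it suffices that `displacement f` tends to 0 at 1, so its continuity on `G` is enough. The
generation hypothesis reduces continuity to suitable sets.

The core is `RelativelyORadial.eventually_forall_dist_lt`: on a relatively o-radial set, `x ↦ f (x *
·)` is continuous for uniform convergence. A failure yields regularly many separated pairs.
Efremovich's lemma separates the two families of values for a subfamily of full size, and the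
distance to one family then contradicts proximal continuity. In the first case this is used at `1 ∈
A * A⁻¹`, giving uniform continuity of the displacement on `closure A`, to which Katětov's theorem
applies. -/

/-! ### Pseudometrics and extension of uniformly continuous functions -/

/-- Every sequence of entourages is controlled by a uniformly continuous pseudometric bounded
by `1`. -/
theorem exists_pseudoMetricSpace_of_entourages {X : Type*} [UniformSpace X]
    (W : ℕ → Set (X × X)) (hW : ∀ n, W n ∈ 𝓤 X) :
    ∃ _ : PseudoMetricSpace X, (∀ ε > 0, {p : X × X | dist p.1 p.2 < ε} ∈ 𝓤 X) ∧
      (∀ x y : X, dist x y ≤ 1) ∧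
      ∀ n (x y : X), dist x y < (1 / 2) ^ (n + 1) → (x, y) ∈ W n := by
  classical
  have step : ∀ (n : ℕ) (V : {V : SetRel X X // V ∈ 𝓤 X ∧ V.IsSymm}),
      ∃ V' : {V : SetRel X X // V ∈ 𝓤 X ∧ V.IsSymm},
        V'.1 ⊆ W n ∧ SetRel.comp V'.1 (SetRel.comp V'.1 V'.1) ⊆ V.1 := by
    intro n V
    obtain ⟨t, ht, hts, htV⟩ := comp_symm_mem_uniformity_sets V.2.1
    obtain ⟨t', ht', hts', htV'⟩ := comp_symm_mem_uniformity_sets (inter_mem ht (hW n))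
    have hsub : t' ⊆ t ∩ W n := (subset_comp_self_of_mem_uniformity ht').trans htV'
    refine ⟨⟨t', ht', hts'⟩, fun p hp ↦ (hsub hp).2, ?_⟩
    exact (SetRel.comp_subset_comp (hsub.trans inter_subset_left)
      (htV'.trans inter_subset_left)).trans htV
  choose! next hnextW hnextC using step
  let S : ℕ → {V : SetRel X X // V ∈ 𝓤 X ∧ V.IsSymm} := fun n ↦
    Nat.rec (next 0 ⟨univ, univ_mem, ⟨fun _ _ _ ↦ trivial⟩⟩) (fun n V ↦ next (n + 1) V) n
  let U : ℕ → SetRel X X := fun n ↦ (S n).1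
  have hUmem : ∀ n, U n ∈ 𝓤 X := fun n ↦ (S n).2.1
  have hUsymm : ∀ n, (U n).IsSymm := fun n ↦ (S n).2.2
  have hUW : ∀ n, U n ⊆ W n := by
    rintro (_ | n)
    · exact hnextW 0 _
    · exact hnextW (n + 1) _
  have hUcomp : ∀ n, SetRel.comp (U (n + 1)) (SetRel.comp (U (n + 1)) (U (n + 1))) ⊆ U n :=
    fun n ↦ hnextC (n + 1) _
  have hUrefl : ∀ n x, (x, x) ∈ U n := fun n x ↦ refl_mem_uniformity (hUmem n)
  have hUanti : Antitone U := antitone_nat_of_succ_le fun n p hp ↦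
    hUcomp n ⟨p.2, hp, p.2, hUrefl (n + 1) p.2, hUrefl (n + 1) p.2⟩
  -- Frink's metrization: the triple compositions in `hUcomp` make the chain pseudometric of `d` at
  -- least `d / 2`.
  let d : X → X → NNReal := fun x y ↦ if h : ∃ n, (x, y) ∉ U n then (1 / 2) ^ Nat.find h else 0
  have hd_self : ∀ x, d x x = 0 := fun x ↦ by simp [d, hUrefl]
  have hd_symm : ∀ x y, d x y = d y x := fun x y ↦ by
    have : ∀ n, (x, y) ∈ U n ↔ (y, x) ∈ U n := fun n ↦
      ⟨fun h ↦ (hUsymm n).symm _ _ h, fun h ↦ (hUsymm n).symm _ _ h⟩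
    simp only [d, this]
  have hr : (1 / 2 : NNReal) ∈ Ioo (0 : NNReal) 1 :=
    ⟨half_pos one_pos, NNReal.half_lt_self one_ne_zero⟩
  have hle_d : ∀ {x y : X} {n : ℕ}, (1 / 2) ^ n ≤ d x y ↔ (x, y) ∉ U n := by
    intro x y n
    dsimp only [d]
    split_ifs with h
    · rw [(pow_right_strictAnti₀ hr.1 hr.2).le_iff_ge, Nat.find_le_iff]
      exact ⟨fun ⟨m, hmn, hm⟩ hn => hm (hUanti hmn hn), fun h => ⟨n, le_rfl, h⟩⟩
    · push Not at h
      simp only [h, not_true, (pow_pos hr.1 _).not_ge]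
  have hd_one : ∀ x y, d x y ≤ 1 := by
    intro x y
    dsimp only [d]
    split_ifs with h
    · exact pow_le_one₀ hr.1.le hr.2.le
    · exact zero_le_one
  let m := PseudoMetricSpace.ofPreNNDist d hd_self hd_symm
  have hdist_le : ∀ x y, dist x y ≤ d x y := PseudoMetricSpace.dist_ofPreNNDist_le _ _ _
  have hd_le : ∀ x y, ↑(d x y) ≤ 2 * dist x y := by
    refine PseudoMetricSpace.le_two_mul_dist_ofPreNNDist _ _ _ fun x₁ x₂ x₃ x₄ => ?_
    by_cases H : ∃ n, (x₁, x₄) ∉ U n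
    · refine (dif_pos H).trans_le ?_
      rw [← div_le_iff₀' zero_lt_two, ← mul_one_div (_ ^ _), ← pow_succ]
      simp only [le_max_iff, hle_d, ← not_and_or]
      rintro ⟨h₁₂, h₂₃, h₃₄⟩
      exact Nat.find_spec H (hUcomp _ ⟨x₂, h₁₂, x₃, h₂₃, h₃₄⟩)
    · exact (dif_neg H).trans_le zero_le
  refine ⟨m, fun ε hε ↦ ?_, fun x y ↦ (hdist_le x y).trans (hd_one x y), fun n x y hxy ↦ ?_⟩
  · obtain ⟨n, hn⟩ := exists_pow_lt_of_lt_one hε (by norm_num : (1 / 2 : ℝ) < 1)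
    refine mem_of_superset (hUmem n) fun p hp ↦ ?_
    have h1 : d p.1 p.2 < (1 / 2) ^ n := by
      rw [← not_le, hle_d, not_not]
      exact hp
    have h2 : (d p.1 p.2 : ℝ) < (1 / 2) ^ n := by exact_mod_cast h1
    exact (hdist_le _ _).trans_lt (h2.trans hn)
  · refine hUW n ?_
    have h1 : (d x y : ℝ) < (1 / 2) ^ n := by
      refine (hd_le x y).trans_lt ?_
      rw [pow_succ] at hxy
      linarith
    have h2 : d x y < (1 / 2) ^ n := by exact_mod_cast h1
    rwa [← not_le, hle_d, not_not] at h2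

/-- **Katětov's extension theorem**: a bounded uniformly continuous real function on a subset of a
uniform space extends to a uniformly continuous function on the whole space. -/
theorem exists_uniformContinuous_extension {X : Type*} [UniformSpace X] {f : X → ℝ} {s : Set X}
    (hbdd : ∀ x ∈ s, ∀ y ∈ s, |f x - f y| ≤ 1)
    (hf : ∀ ε > 0, {p : X × X | p.1 ∈ s → p.2 ∈ s → |f p.1 - f p.2| < ε} ∈ 𝓤 X) :
    ∃ g : X → ℝ, UniformContinuous g ∧ EqOn g f s := by
  obtain ⟨m, hm, -, hmW⟩ := exists_pseudoMetricSpace_of_entourages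
    (fun n : ℕ ↦ {p : X × X | p.1 ∈ s → p.2 ∈ s → |f p.1 - f p.2| < (1 / 2) ^ n})
    (fun n ↦ hf _ (by positivity))
  have hpow : ∀ n : ℕ, ∀ x ∈ s, ∀ y ∈ s, m.dist x y < (1 / 2) ^ (n + 1) →
      |f x - f y| < (1 / 2) ^ n := fun n x hx y hy h ↦ hmW n x y h hx hy
  -- If `4 * dist x y < |f x - f y| ≤ (1 / 2) ^ n`, then `dist x y < (1 / 2) ^ (n + 2)`, so `hpow (n
  -- + 1)` contradicts the lower dyadic bound; hence the constant 4.
  have hlip : @LipschitzOnWith X ℝ m.toPseudoEMetricSpace _ 4 f s := by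
    let _ := m
    refine LipschitzOnWith.of_dist_le_mul fun x hx y hy ↦ ?_
    rw [Real.dist_eq]
    change _ ≤ (4 : ℝ) * dist x y
    by_contra! hlt
    obtain ⟨n, hn1, hn2⟩ : ∃ n : ℕ, (1 / 2 : ℝ) ^ (n + 1) < |f x - f y| ∧
        |f x - f y| ≤ (1 / 2) ^ n :=
      exists_nat_pow_near_of_lt_one (lt_of_le_of_lt (by positivity) hlt) (hbdd x hx y hy)
        (by norm_num) (by norm_num)
    have := hpow (n + 1) x hx y hy (by
      change dist x y < _
      rw [pow_succ, pow_succ]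
      linarith)
    linarith
  obtain ⟨g, hg, hgf⟩ := @LipschitzOnWith.extend_real X m _ _ _ hlip
  refine ⟨g, Metric.uniformity_basis_dist.tendsto_right_iff.2 fun ε hε ↦ ?_, hgf.symm⟩
  filter_upwards [hm (ε / 4) (by positivity)] with p hp
  have h4 : dist (g p.1) (g p.2) ≤ 4 * m.dist p.1 p.2 := hg.dist_le_mul p.1 p.2
  have hp' : m.dist p.1 p.2 < ε / 4 := hp
  change dist (g p.1) (g p.2) < ε
  linarith

/-! ### Separating families of pairs -/

/-- A version of Efremovich's lemma for families of pairs indexed by a set of regular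
cardinality. -/
theorem exists_subset_le_dist_of_isRegular {I : Type u} {Y : Type*} [PseudoMetricSpace Y]
    {J : Set I} (hJ : (Cardinal.mk J).IsRegular) (a b : I → Y) {δ : ℝ} (hδ : 0 < δ)
    (hab : ∀ j ∈ J, δ ≤ dist (a j) (b j)) :
    ∃ L ⊆ J, Cardinal.mk L = Cardinal.mk J ∧ ∀ j ∈ L, ∀ k ∈ L, δ / 4 ≤ dist (a j) (b k) := by
  -- If `|J|` many `a j` cluster near one point, these indices already work: each `b k` is far from
  -- its own `a k`, hence from the whole cluster. The case of the `b j` is symmetric.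
  by_cases ha : ∃ c, Cardinal.mk {j | j ∈ J ∧ dist (a j) c < δ / 4} = Cardinal.mk J
  · obtain ⟨c, hc⟩ := ha
    refine ⟨_, fun j hj ↦ hj.1, hc, fun j hj k hk ↦ ?_⟩
    have h1 := hab k hk.1
    have h2 := dist_triangle4 (a k) c (a j) (b k)
    have h3 := dist_comm c (a j)
    linarith [hj.2, hk.2]
  by_cases hb : ∃ c, Cardinal.mk {j | j ∈ J ∧ dist (b j) c < δ / 4} = Cardinal.mk J
  · obtain ⟨c, hc⟩ := hb
    refine ⟨_, fun j hj ↦ hj.1, hc, fun j hj k hk ↦ ?_⟩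
    have h1 := hab j hj.1
    have h2 := dist_triangle4 (a j) (b k) c (b j)
    have h3 := dist_comm c (b j)
    linarith [hj.2, hk.2]
  have hlt : ∀ p : I → Prop, Cardinal.mk {j | j ∈ J ∧ p j} ≠ Cardinal.mk J →
      Cardinal.mk {j | j ∈ J ∧ p j} < Cardinal.mk J := fun p hp ↦
    lt_of_le_of_ne (Cardinal.mk_le_mk_of_subset fun j hj ↦ hj.1) hp
  push Not at ha hb
  obtain ⟨L, hL⟩ := zorn_subset {L : Set I | L ⊆ J ∧ ∀ j ∈ L, ∀ k ∈ L, δ / 4 ≤ dist (a j) (b k)} (by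
    intro C hC hchain
    refine ⟨⋃₀ C, ⟨sUnion_subset fun s hs ↦ (hC hs).1, ?_⟩, fun s hs ↦ subset_sUnion_of_mem hs⟩
    rintro j ⟨s, hs, hj⟩ k ⟨t, ht, hk⟩
    rcases hchain.total hs ht with hst | hts
    · exact (hC ht).2 j (hst hj) k hk
    · exact (hC hs).2 j hj k (hts hk))
  refine ⟨L, hL.prop.1, ?_, hL.prop.2⟩
  -- With no clusters, each `l ∈ L` forbids fewer than `|J|` indices. If `|L| < |J|`, regularity
  -- leaves an index that can be added to the maximal `L`.
  by_contra hne
  have hLlt : Cardinal.mk L < Cardinal.mk J :=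
    lt_of_le_of_ne (Cardinal.mk_le_mk_of_subset hL.prop.1) hne
  let bad : I → Set I := fun l ↦
    {j | j ∈ J ∧ dist (a j) (b l) < δ / 4} ∪ {j | j ∈ J ∧ dist (b j) (a l) < δ / 4}
  have hbadlt : ∀ l, Cardinal.mk (bad l) < Cardinal.mk J := fun l ↦
    (Cardinal.mk_union_le _ _).trans_lt
      (Cardinal.add_lt_of_lt hJ.aleph0_le (hlt _ (ha _)) (hlt _ (hb _)))
  have hUlt : Cardinal.mk (⋃ l ∈ L, bad l) < Cardinal.mk J :=
    (Cardinal.card_biUnion_lt_iff_forall_of_isRegular hJ hLlt).2 fun l _ ↦ hbadlt l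
  have hall : Cardinal.mk ↑(L ∪ ⋃ l ∈ L, bad l) < Cardinal.mk J :=
    (Cardinal.mk_union_le _ _).trans_lt (Cardinal.add_lt_of_lt hJ.aleph0_le hLlt hUlt)
  obtain ⟨j, hjJ, hj⟩ : ∃ j ∈ J, j ∉ L ∪ ⋃ l ∈ L, bad l := by
    by_contra! hsub
    exact hall.not_ge (Cardinal.mk_le_mk_of_subset hsub)
  simp only [mem_union, mem_iUnion, not_or, not_exists, bad, mem_ofPred_eq, not_and, not_lt] at hj
  refine hj.1 (hL.le_of_ge ⟨insert_subset hjJ hL.prop.1, ?_⟩ (subset_insert j L) (mem_insert j L))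
  rintro k (rfl | hk) l (rfl | hl)
  · linarith [hab _ hjJ]
  · exact (hj.2 l hl).1 hjJ
  · rw [dist_comm]
    exact (hj.2 _ hk).2 hjJ
  · exact hL.prop.2 k hk l hl

/-! ### Proximally continuous maps into bounded pseudometric spaces -/

theorem ProximallyContinuous.mono_right {X Y : Type*} [UniformSpace X] {u₁ u₂ : UniformSpace Y}
    {f : X → Y} (hf : @ProximallyContinuous X Y _ u₁ f) (h : u₁ ≤ u₂) :
    @ProximallyContinuous X Y _ u₂ f := fun g hg hb ↦
  hf g (fun _ hs ↦ h (hg hs)) hb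

theorem ProximallyContinuous.uniformContinuous_infDist {X Y : Type*} [UniformSpace X]
    [PseudoMetricSpace Y] {f : X → Y} (hf : ProximallyContinuous f)
    (hY : ∀ x y : Y, dist x y ≤ 1) (s : Set Y) :
    UniformContinuous fun x ↦ Metric.infDist (f x) s := by
  refine hf (fun y ↦ Metric.infDist y s) (Metric.uniformContinuous_infDist_pt s) ⟨1, fun y ↦ ?_⟩
  rw [abs_of_nonneg Metric.infDist_nonneg]
  obtain rfl | ⟨z, hz⟩ := s.eq_empty_or_nonempty
  · simp
  · exact (Metric.infDist_le_dist_of_mem hz).trans (hY y z)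

theorem ProximallyContinuous.continuous {X Y : Type*} [UniformSpace X]
    [PseudoMetricSpace Y] {f : X → Y} (hf : ProximallyContinuous f)
    (hY : ∀ x y : Y, dist x y ≤ 1) : Continuous f := by
  rw [continuous_iff_continuousAt]
  intro x
  have h := (hf.uniformContinuous_infDist hY {f x}).continuous.tendsto x
  simp only [Metric.infDist_singleton, dist_self] at h
  exact tendsto_iff_dist_tendsto_zero.2 h

/-! ### The displacement function -/

section Displacement

variable {G : Type*} [Group G] {Y : Type*} [PseudoMetricSpace Y] {f : G → Y}

/-- The largest distance by which left translation by `s` moves the values of `f`. -/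
noncomputable def displacement (f : G → Y) (s : G) : ℝ := ⨆ g, dist (f (s * g)) (f g)

theorem dist_le_displacement (hY : ∀ x y : Y, dist x y ≤ 1) (s g : G) :
    dist (f (s * g)) (f g) ≤ displacement f s :=
  le_ciSup (f := fun g ↦ dist (f (s * g)) (f g))
    ⟨1, by rintro _ ⟨g, rfl⟩; exact hY _ _⟩ g

theorem displacement_nonneg (s : G) : 0 ≤ displacement f s :=
  Real.iSup_nonneg fun _ ↦ dist_nonneg

theorem displacement_le_one (hY : ∀ x y : Y, dist x y ≤ 1) (s : G) : displacement f s ≤ 1 :=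
  ciSup_le fun _ ↦ hY _ _

theorem displacement_one : displacement f (1 : G) = 0 := by simp [displacement]

theorem displacement_le_add (hY : ∀ x y : Y, dist x y ≤ 1) {s t : G} {c : ℝ}
    (h : ∀ g, dist (f (s * g)) (f (t * g)) ≤ c) : displacement f s ≤ c + displacement f t :=
  ciSup_le fun g ↦ (dist_triangle _ (f (t * g)) _).trans
    (add_le_add (h g) (dist_le_displacement hY t g))

theorem abs_displacement_sub_le (hY : ∀ x y : Y, dist x y ≤ 1) {s t : G} {c : ℝ}
    (h : ∀ g, dist (f (s * g)) (f (t * g)) ≤ c) : |displacement f s - displacement f t| ≤ c := by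
  have h1 := displacement_le_add hY h
  have h2 := displacement_le_add hY fun g ↦ (dist_comm _ _).trans_le (h g)
  rw [abs_le]
  constructor <;> linarith

end Displacement

/-! ### Displacement on relatively o-radial sets -/

section TopologicalGroup

variable {G : Type u} [Group G] [TopologicalSpace G] [IsTopologicalGroup G]

theorem mem_uniformity_rightUniformSpace {S : Set (G × G)} :
    S ∈ @uniformity G (IsTopologicalGroup.rightUniformSpace G) ↔
      ∀ᶠ v in 𝓝 (1 : G), ∀ g, (g, v * g) ∈ S := by
  change S ∈ comap (fun p : G × G ↦ p.2 * p.1⁻¹) (𝓝 1) ↔ _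
  rw [mem_comap]
  constructor
  · rintro ⟨t, ht, hts⟩
    filter_upwards [ht] with v hv g
    exact hts (by simpa using hv)
  · exact fun h ↦ ⟨_, h, fun p hp ↦ by simpa using hp p.1⟩

variable {Y : Type v} [PseudoMetricSpace Y] {f : G → Y}

theorem RelativelyORadial.eventually_forall_dist_lt
    (hf : @ProximallyContinuous G Y (IsTopologicalGroup.rightUniformSpace G) _ f)
    (hY : ∀ x y : Y, dist x y ≤ 1) {A : Set G} (hA : RelativelyORadial A) {a : G} (ha : a ∈ A)
    {ε : ℝ} (hε : 0 < ε) : ∀ᶠ x in 𝓝[A] a, ∀ g, dist (f (x * g)) (f (a * g)) < ε := by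
  have hcont : Continuous f :=
    @ProximallyContinuous.continuous G Y (IsTopologicalGroup.rightUniformSpace G) _ f hf hY
  by_contra hne
  rw [not_eventually] at hne
  push Not at hne
  let I : Type u := {x // x ∈ A ∧ ∃ g, ε ≤ dist (f (x * g)) (f (a * g))}
  choose g hg using fun i : I ↦ i.2.2
  -- On the closure of `O i`, the value at `y * g i` stays within `ε / 8` of that at `i.1 * g i`,
  -- which excludes `a`.
  let O : I → Set G := fun i ↦ {y | dist (f (y * g i)) (f (i.1 * g i)) < ε / 8}
  have hO : ∀ i, IsOpen (O i) := fun i ↦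
    isOpen_lt (by fun_prop) continuous_const
  have hmem : ∀ i : I, i.1 ∈ O i := fun i ↦ by simp [O, hε]
  have hcl : a ∈ closure (⋃ i, O i ∩ A) := by
    rw [mem_closure_iff_frequently]
    refine (frequently_nhdsWithin_iff.1 hne).mono fun x hx ↦ ?_
    exact mem_iUnion.2 ⟨⟨x, hx.2, hx.1⟩, hmem ⟨x, hx.2, hx.1⟩, hx.2⟩
  have hncl : a ∉ ⋃ i, closure (O i) := by
    simp only [mem_iUnion, not_exists]
    intro i hi
    have hsub : closure (O i) ⊆ {y | dist (f (y * g i)) (f (i.1 * g i)) ≤ ε / 8} :=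
      closure_minimal (fun y hy ↦ (show dist _ _ < _ from hy).le) (isClosed_le (by fun_prop) continuous_const)
    have h1 : dist (f (a * g i)) (f (i.1 * g i)) ≤ ε / 8 := hsub hi
    have h2 := hg i
    rw [dist_comm] at h2
    linarith
  obtain ⟨J, hJ, hJL⟩ := hA I O hO a ha ⟨hcl, hncl⟩
  obtain ⟨L, hLJ, hLcard, hL⟩ := exists_subset_le_dist_of_isRegular hJ
    (fun i ↦ f (i.1 * g i)) (fun i ↦ f (a * g i)) hε fun i _ ↦ hg i
  set s : Set Y := (fun i ↦ f (a * g i)) '' L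
  have hinf := @ProximallyContinuous.uniformContinuous_infDist G Y
    (IsTopologicalGroup.rightUniformSpace G) _ f hf hY s
  -- The choice `ε / 16` works because `ε / 16 + ε / 8 < ε / 4`, the separation of `s` from the
  -- values `f (j.1 * g j)`.
  have hs : ∀ᶠ v in 𝓝 (1 : G), ∀ x,
      dist (Metric.infDist (f x) s) (Metric.infDist (f (v * x)) s) < ε / 16 :=
    mem_uniformity_rightUniformSpace.1
      (hinf (Metric.dist_mem_uniformity (by positivity : 0 < ε / 16)))
  have htend : Tendsto (fun y ↦ y * a⁻¹) (𝓝 a) (𝓝 1) := by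
    have : Continuous fun y : G ↦ y * a⁻¹ := by fun_prop
    simpa using this.tendsto a
  obtain ⟨y, hyO, hy⟩ :=
    ((mem_closure_iff_frequently.1 (hJL L hLJ hLcard)).and_eventually
      (htend.eventually hs)).exists
  obtain ⟨j, hjL, hyj⟩ : ∃ j ∈ L, y ∈ O j := by simpa using hyO
  -- Left translation by `y * a⁻¹` takes `a * g j` to `y * g j` whatever `j` is, so `y` can be
  -- chosen before `j`.
  have h1 := hy (a * g j)
  rw [show y * a⁻¹ * (a * g j) = y * g j by group] at h1
  have h0 : Metric.infDist (f (a * g j)) s = 0 :=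
    Metric.infDist_zero_of_mem (mem_image_of_mem _ hjL)
  rw [h0, Real.dist_eq, zero_sub, abs_neg, abs_of_nonneg Metric.infDist_nonneg] at h1
  have h2 : ε / 4 ≤ Metric.infDist (f (j.1 * g j)) s := by
    refine (Metric.le_infDist ⟨_, mem_image_of_mem _ hjL⟩).2 ?_
    rintro _ ⟨k, hk, rfl⟩
    exact hL j hjL k hk
  have h3 := Metric.infDist_le_infDist_add_dist (s := s) (x := f (j.1 * g j)) (y := f (y * g j))
  have h4 : dist (f (y * g j)) (f (j.1 * g j)) < ε / 8 := hyj
  rw [dist_comm] at h4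
  linarith

theorem RelativelyORadial.continuous_displacement
    (hf : @ProximallyContinuous G Y (IsTopologicalGroup.rightUniformSpace G) _ f)
    (hY : ∀ x y : Y, dist x y ≤ 1) {A : Set G} (hA : RelativelyORadial A) :
    Continuous fun x : A ↦ displacement f (x : G) := by
  suffices ContinuousOn (displacement f) A from continuousOn_iff_continuous_domRestrict.1 this
  refine fun a ha ↦ Metric.tendsto_nhds.2 fun ε hε ↦ ?_
  filter_upwards [hA.eventually_forall_dist_lt hf hY ha (half_pos hε)] with x hx
  rw [Real.dist_eq]
  exact (abs_displacement_sub_le hY fun g ↦ (hx g).le).trans_lt (half_lt_self hε)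

/-- For `p, q ∈ A`, comparing `f (q * z)` with `f (p * z)` amounts to translating `p * z` by `q *
p⁻¹ ∈ A * A⁻¹`. Uniform control at 1 on `A * A⁻¹` is therefore uniform continuity on `A`, and it
passes to the closure. -/
theorem exists_continuous_extension_displacement
    (hf : @ProximallyContinuous G Y (IsTopologicalGroup.rightUniformSpace G) _ f)
    (hY : ∀ x y : Y, dist x y ≤ 1) {A : Set G} (hA : RelativelyORadial (A * A⁻¹)) :
    ∃ g : G → ℝ, Continuous g ∧ EqOn g (displacement f) (closure A) := by
  have hcont : Continuous f :=
    @ProximallyContinuous.continuous G Y (IsTopologicalGroup.rightUniformSpace G) _ f hf hY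
  obtain rfl | ⟨a, ha⟩ := A.eq_empty_or_nonempty
  · exact ⟨0, continuous_zero, by simp⟩
  have hone : (1 : G) ∈ A * A⁻¹ := ⟨a, ha, a⁻¹, inv_mem_inv.2 ha, mul_inv_cancel a⟩
  obtain ⟨g, hg, hgf⟩ := @exists_uniformContinuous_extension G
    (IsTopologicalGroup.rightUniformSpace G) (displacement f) (closure A) (by
      intro x _ y _
      have := displacement_nonneg (f := f) x
      have := displacement_nonneg (f := f) y
      have := displacement_le_one (f := f) hY x
      have := displacement_le_one (f := f) hY y
      rw [abs_le]
      constructor <;> linarith) (by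
      intro ε hε
      rw [mem_uniformity_rightUniformSpace]
      obtain ⟨W, hW, hWo, hW1⟩ := eventually_nhds_iff.1
        (eventually_nhdsWithin_iff.1 (hA.eventually_forall_dist_lt hf hY hone (half_pos hε)))
      filter_upwards [hWo.mem_nhds hW1] with v hv x hx hvx
      refine (abs_displacement_sub_le hY (c := ε / 2) fun z ↦ ?_).trans_lt (half_lt_self hε)
      have hSo : IsOpen {p : G × G | p.2 * p.1⁻¹ ∈ W} := hWo.preimage (by fun_prop)
      -- The condition on the quotient is open, so pairs from `closure A` satisfying it are limits
      -- of pairs from `A` satisfying it; the estimate on `f` is a closed condition.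
      have hmem : (x, v * x) ∈ closure ({p : G × G | p.2 * p.1⁻¹ ∈ W} ∩ A ×ˢ A) := by
        refine hSo.inter_closure ⟨by simpa using hv, ?_⟩
        rw [closure_prod_eq]
        exact ⟨hx, hvx⟩
      have hcl : IsClosed {p : G × G | dist (f (p.1 * z)) (f (p.2 * z)) ≤ ε / 2} :=
        isClosed_le (by fun_prop) continuous_const
      refine closure_minimal ?_ hcl hmem
      rintro ⟨p, q⟩ ⟨hpq, hp, hq⟩
      have := hW _ hpq ⟨q, hq, p⁻¹, inv_mem_inv.2 hp, rfl⟩ (p * z)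
      rw [dist_comm] at this
      simpa [mul_assoc] using this.le)
  exact ⟨g, @UniformContinuous.continuous G ℝ (IsTopologicalGroup.rightUniformSpace G) _ g hg, hgf⟩

end TopologicalGroup

theorem theorem2p4 (G : Type u) [Group G] [TopologicalSpace G] [IsTopologicalGroup G]
    (h : FunctionallyGenerated G {B | ∃ A : Set G, RelativelyORadial (A * A⁻¹) ∧ B = closure A} ∨
      StronglyFunctionallyGenerated G {A | RelativelyORadial A}) :
    ProximallyFineGroup.{u, v} G := by
  intro Y _ f hf U hU
  obtain ⟨m, hm, hY, hmU⟩ := exists_pseudoMetricSpace_of_entourages (fun _ : ℕ ↦ U) fun _ ↦ hU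
  have hf' := @ProximallyContinuous.mono_right G Y (IsTopologicalGroup.rightUniformSpace G) _
    m.toUniformSpace f hf fun s hs ↦ by
      obtain ⟨ε, hε, hεs⟩ := (@Metric.mem_uniformity_dist Y m s).1 hs
      exact mem_of_superset (hm ε hε) fun p hp ↦ hεs hp
  have hcont : Continuous (displacement f) := by
    by_contra hd
    obtain h | h := h
    · obtain ⟨_, ⟨A, hA, rfl⟩, hne⟩ := h _ hd
      exact hne (exists_continuous_extension_displacement hf' hY hA)
    · obtain ⟨A, hA, hne⟩ := h _ hd
      exact hne (hA.continuous_displacement hf' hY)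
  change _ ∈ @uniformity G (IsTopologicalGroup.rightUniformSpace G)
  rw [mem_uniformity_rightUniformSpace]
  -- The sequence of entourages is constantly `U`, so the threshold of index 0 suffices.
  have h1 : ∀ᶠ s in 𝓝 (1 : G), displacement f s < (1 / 2) ^ (0 + 1) :=
    hcont.continuousAt.eventually_lt_const (by rw [displacement_one]; norm_num)
  filter_upwards [h1] with v hv g
  refine hmU 0 _ _ ?_
  rw [dist_comm]
  exact (dist_le_displacement hY v g).trans_lt hv
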